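/- Let $n\ge 1$, and write $r=|z|^2$ for $z\in\mathbb C^n$. A smooth Kähler metric $g=(g_{i\bar\jmath})$ on $\mathbb C^n$ is said to be generated by a smooth function $\xi:[0,\infty)\to\mathbb R$ with $\xi(0)=0$ if, for some constant $C>0$, $$g_{i\bar\jmath}(z)=f(r)\,\delta_{ij}+f'(r)\,\overline{z_i}\,z_j,\qquad h(r)=C\exp\Big(-\int_0^r\frac{\xi(s)}{s}\,ds\Big),\qquad f(r)=\frac1r\int_0^r h(s)\,ds,\quad f(0)=h(0).$$ Let $g$ be a smooth $U(n)$-invariant Kähler metric on $\mathbb C^n$ generated by $\xi$, and suppose that there is a constant $c$ such that $$\int_1^r\frac{1-\xi(s)}{s}\,ds\le c\qquad\text{for all } r\ge 1.$$ Then there is a constant $c_1>0$, depending only on $g$, with the following property: if $\widetilde g$ is a smooth $U(n)$-invariant Kähler metric on $\mathbb C^n$ whose holomorphic bisectional curvature is bounded above by $1$, that is, $$R_{\widetilde g}(X,\bar X,Y,\bar Y)\le \widetilde g(X,\bar X)\,\widetilde g(Y,\bar Y)\qquad\text{for all } z\in\mathbb C^n \text{ and } X,Y\in T^{1,0}_z\mathbb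 C^n,$$ where $$R_{i\bar\jmath k\bar l}=-\partial_k\partial_{\bar l}\,\widetilde g_{i\bar\jmath}+\sum_{p,q}\widetilde g^{p\bar q}\,\partial_k\widetilde g_{i\bar q}\,\partial_{\bar l}\,\widetilde g_{p\bar\jmath},$$ and if $g\ge\alpha\,\widetilde g$ everywhere on $\mathbb C^n$ for some $\alpha>0$, then $\alpha\le c_1$. -/

import Mathlib

open scoped ContDiff ComplexOrder

noncomputable section

namespace UnKahler

/-- The Wirtinger derivative `∂F/∂z_k` of a function on `ℂⁿ`. -/
def dz {n : ℕ} (k : Fin n) (F : (Fin n → ℂ) → ℂ) (z : Fin n → ℂ) : ℂ :=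
  (1 / 2 : ℂ) * (fderiv ℝ F z (Pi.single k 1) - Complex.I * fderiv ℝ F z (Pi.single k Complex.I))

/-- The Wirtinger derivative `∂F/∂z̄_k` of a function on `ℂⁿ`. -/
def dzbar {n : ℕ} (k : Fin n) (F : (Fin n → ℂ) → ℂ) (z : Fin n → ℂ) : ℂ :=
  (1 / 2 : ℂ) * (fderiv ℝ F z (Pi.single k 1) + Complex.I * fderiv ℝ F z (Pi.single k Complex.I))

/-- A smooth Kähler metric on `ℂⁿ`, given by its components `g z i j = g_{i j̄}(z)` in the standard
coordinates: smooth, Hermitian positive definite, and with closed Kähler form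
(`∂_k g_{i j̄} = ∂_i g_{k j̄}`; the conjugate identities follow from Hermitian symmetry). -/
structure KahlerMetric (n : ℕ) where
  coeff : (Fin n → ℂ) → Matrix (Fin n) (Fin n) ℂ
  smooth : ∀ i j, ContDiff ℝ ∞ (fun z => coeff z i j)
  posDef : ∀ z, (coeff z).PosDef
  closed : ∀ i j k z, dz k (fun w => coeff w i j) z = dz i (fun w => coeff w k j) z

namespace KahlerMetric

variable {n : ℕ}

/-- The Hermitian form `g(X, Ȳ) = ∑ g_{i j̄} X_i Ȳ_j` at `z`. -/
def herm (g : KahlerMetric n) (z X Y : Fin n → ℂ) : ℂ :=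
  ∑ i, ∑ j, g.coeff z i j * X i * star (Y j)

/-- The squared length `g(X, X̄)` at `z` (the sum is real, since `g` is Hermitian). -/
def sqNorm (g : KahlerMetric n) (z X : Fin n → ℂ) : ℝ := (g.herm z X X).re

/-- `U(n)`-invariance: `U^* g = g` for every unitary linear map `z ↦ U z`. -/
def IsUnitaryInvariant (g : KahlerMetric n) : Prop :=
  ∀ U ∈ Matrix.unitaryGroup (Fin n) ℂ, ∀ z X Y : Fin n → ℂ,
    g.herm (U.mulVec z) (U.mulVec X) (U.mulVec Y) = g.herm z X Y

/-- The curvature tensor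
`R_{i j̄ k l̄} = - ∂_k ∂_{l̄} g_{i j̄} + ∑_{p, q} g^{p q̄} ∂_k g_{i q̄} ∂_{l̄} g_{p j̄}`.
Here `g^{p q̄}` is defined by `∑_q g^{p q̄} g_{s q̄} = δ_{p s}`, so it is the `(q, p)` entry
of the inverse matrix of `(g_{i j̄})`. -/
def curvature (g : KahlerMetric n) (i j k l : Fin n) (z : Fin n → ℂ) : ℂ :=
  - dz k (dzbar l (fun w => g.coeff w i j)) z
    + ∑ p, ∑ q, (g.coeff z)⁻¹ q p * dz k (fun w => g.coeff w i q) z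
        * dzbar l (fun w => g.coeff w p j) z

/-- The holomorphic bisectional curvature `R(X, X̄, Y, Ȳ) / (|X|² |Y|²)` at `z`
(the numerator is real). It is meant for nonzero `X` and `Y`. -/
def bisectional (g : KahlerMetric n) (z X Y : Fin n → ℂ) : ℝ :=
  (∑ i, ∑ j, ∑ k, ∑ l,
    g.curvature i j k l z * X i * star (X j) * Y k * star (Y l)).re
      / (g.sqNorm z X * g.sqNorm z Y)

/-- The bisectional curvature is bounded above by `K`. -/
def BisectionalLE (g : KahlerMetric n) (K : ℝ) : Prop :=
  ∀ z X Y : Fin n → ℂ, X ≠ 0 → Y ≠ 0 → g.bisectional z X Y ≤ K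

end KahlerMetric

/-- `h_ξ(r) = C exp(-∫_0^r ξ(s)/s ds)`. -/
def hFun (C : ℝ) (ξ : ℝ → ℝ) (r : ℝ) : ℝ :=
  C * Real.exp (-∫ s in (0 : ℝ)..r, ξ s / s)

/-- `f_ξ(r) = (1/r) ∫_0^r h_ξ(s) ds` for `r ≠ 0`, and `f_ξ(0) = h_ξ(0)`. -/
def fFun (C : ℝ) (ξ : ℝ → ℝ) (r : ℝ) : ℝ :=
  if r = 0 then hFun C ξ 0 else (1 / r) * ∫ s in (0 : ℝ)..r, hFun C ξ s

/-- `g` is generated by `ξ : [0, ∞) → ℝ`: `ξ` is smooth, `ξ(0) = 0`, and for some `C > 0`,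
`g_{i j̄} = f_ξ(r) δ_{ij} + f_ξ'(r) z̄_i z_j` with `r = |z|²`.
Only the values of `ξ` on `[0, ∞)` matter; at `z = 0` the second term vanishes. -/
def KahlerMetric.IsGeneratedBy {n : ℕ} (g : KahlerMetric n) (ξ : ℝ → ℝ) : Prop :=
  ContDiffOn ℝ ∞ ξ (Set.Ici 0) ∧ ξ 0 = 0 ∧
    ∃ C : ℝ, 0 < C ∧ ∀ (z : Fin n → ℂ) (i j : Fin n),
      g.coeff z i j =
        (if i = j then ((fFun C ξ (∑ m, ‖z m‖ ^ 2) : ℝ) : ℂ) else 0)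
          + ((deriv (fFun C ξ) (∑ m, ‖z m‖ ^ 2) : ℝ) : ℂ) * star (z i) * z j

end UnKahler

end

/-! Both metrics are compared along one coordinate axis, in the radial direction. There the
generated metric has coefficient `h(r)`, and the integral hypothesis on `ξ` says exactly that `r
h(r)` stays below some `M` (`exists_bound_mul_hFun`). The other metric restricts to the complex axis
as a rotationally symmetric metric `φ(|w|)`. By Cauchy–Schwarz the restriction has no more curvature
than the ambient metric, so the bound `1` survives, which means Gauss curvature at most `2`.
Sturm-type comparison with the round sphere forces the circles of such a plane to become long enough
that `x²φ(x) > 1/4` somewhere (`exists_quarter_lt_sq_mul_of_curvature_le`,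
`KahlerMetric.exists_quarter_lt_coeff`). At that point `α/4 < α x²φ(x) ≤ x² h(x²) ≤ M`. -/

namespace UnKahler

/-! ### Comparison for rotationally symmetric metrics on the plane -/

/-- A positive radial conformal factor `φ(|w|)` on `ℂ` with curvature at most `1`
cannot satisfy `x ^ 2 * φ x ≤ 1 / 4` everywhere. -/
theorem exists_quarter_lt_sq_mul_of_curvature_le {φ φ' φ'' : ℝ → ℝ}
    (h1 : ∀ x, HasDerivAt φ (φ' x) x) (h2 : ∀ x, HasDerivAt φ' (φ'' x) x) (hpos : ∀ x, 0 < φ x)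
    (hK : ∀ x, 0 < x → -4 * φ x ^ 2 ≤ φ'' x + φ' x / x - φ' x ^ 2 / φ x) :
    ∃ x, 0 < x ∧ 1 / 4 < x ^ 2 * φ x := by
  by_contra! hp
  -- With `ρ = x√φ` (circumference over `2π`) and arc length `s`, `A = ρ_s` and `E = ρ_s²/2 + ρ²`.
  -- The curvature bound reads `ρ_ss ≥ -2ρ`, so `E` cannot decrease while `A ≥ 0`.
  set A : ℝ → ℝ := fun x => 1 + x * φ' x / (2 * φ x) with hA
  set E : ℝ → ℝ := fun x => A x ^ 2 / 2 + x ^ 2 * φ x with hE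
  have hAd : ∀ x, HasDerivAt A (((1 * φ' x + x * φ'' x) * (2 * φ x) - x * φ' x * (2 * φ' x)) /
      (2 * φ x) ^ 2) x := fun x =>
    ((((hasDerivAt_id' x).mul (h2 x)).div ((h1 x).const_mul 2)
      (by have := hpos x; positivity)).const_add 1)
  have hAc : Continuous A := continuous_iff_continuousAt.2 fun x => (hAd x).continuousAt
  have hEd : ∀ x, HasDerivAt E ((2 * A x ^ (2 - 1) * (((1 * φ' x + x * φ'' x) * (2 * φ x)
      - x * φ' x * (2 * φ' x)) / (2 * φ x) ^ 2)) / 2 + ((2 : ℕ) * x ^ (2 - 1) * φ x + x ^ 2 * φ' x)) x :=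
    fun x => (((hAd x).pow 2).div_const 2).add ((hasDerivAt_pow 2 x).mul (h1 x))
  have hEc : Continuous E := continuous_iff_continuousAt.2 fun x => (hEd x).continuousAt
  have hEnn : ∀ x, 0 < x → 0 ≤ A x → 0 ≤ deriv E x := by
    intro x hx hAx
    have hφ := hpos x
    have key : deriv E x = A x * (x / 2 * (φ'' x / φ x + φ' x / (x * φ x) - φ' x ^ 2 / φ x ^ 2
        + 4 * φ x)) := by
      rw [(hEd x).deriv]
      have h3 : A x = (2 * φ x + x * φ' x) / (2 * φ x) := by simp only [hA]; field_simp
      have h4 : 2 * x * φ x + x ^ 2 * φ' x = A x * (2 * x * φ x) := by rw [h3]; field_simp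
      push_cast
      rw [pow_one, pow_one, h4]
      field_simp
      ring
    rw [key]
    have h3 : φ'' x / φ x + φ' x / (x * φ x) - φ' x ^ 2 / φ x ^ 2 + 4 * φ x
        = (φ'' x + φ' x / x - φ' x ^ 2 / φ x + 4 * φ x ^ 2) / φ x := by
      field_simp
    rw [h3]
    have h4 : 0 ≤ φ'' x + φ' x / x - φ' x ^ 2 / φ x + 4 * φ x ^ 2 := by linarith [hK x hx]
    positivity
  have hA0 : A 0 = 1 := by simp [hA]
  have hE0 : E 0 = 1 / 2 := by simp [hE, hA0]
  have hEge : ∀ b, 0 < b → (∀ x, 0 < x → x < b → 0 ≤ A x) → 1 / 2 ≤ E b := by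
    intro b hb hAb
    have hmono : MonotoneOn E (Set.Icc 0 b) := by
      refine monotoneOn_of_deriv_nonneg (convex_Icc 0 b) hEc.continuousOn
        (fun x _ => (hEd x).differentiableAt.differentiableWithinAt) ?_
      intro x hx
      rw [interior_Icc] at hx
      exact hEnn x hx.1 (hAb x hx.1 hx.2)
    rw [← hE0]
    exact hmono ⟨le_rfl, hb.le⟩ ⟨hb.le, le_rfl⟩ hb.le
  have hApos : ∀ x, 0 < x → 0 < A x := by
    intro x₁ hx₁
    by_contra! hneg
    -- Let `b` be the first zero of `A`. Monotonicity gives `E b ≥ 1/2`, whereas `A b = 0` leaves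
    -- only `E b = b²φ(b) ≤ 1/4`.
    have hcpt : IsCompact (Set.Icc 0 x₁ ∩ {x | A x ≤ 0}) :=
      isCompact_Icc.inter_right (isClosed_le hAc continuous_const)
    obtain ⟨b, ⟨hb, hAb⟩, hleast⟩ := hcpt.exists_isLeast ⟨x₁, ⟨hx₁.le, le_rfl⟩, hneg⟩
    have hAb' : A b ≤ 0 := hAb
    have hb0 : 0 < b := by
      rcases hb.1.eq_or_lt with h | h
      · rw [← h, hA0] at hAb'; linarith
      · exact h
    have hlt : ∀ x, 0 ≤ x → x < b → 0 < A x := by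
      intro x hx hxb
      by_contra! h
      exact absurd (hleast ⟨⟨hx, hxb.le.trans hb.2⟩, h⟩) (not_le.2 hxb)
    have hAb0 : 0 ≤ A b := by
      refine ge_of_tendsto (hAc.continuousWithinAt (s := Set.Iio b)) ?_
      filter_upwards [Ioo_mem_nhdsLT hb0] with x hx using (hlt x hx.1.le hx.2).le
    have hz : A b = 0 := le_antisymm hAb' hAb0
    have h5 := hEge b hb0 fun x hx hxb => (hlt x hx.le hxb).le
    have h6 := hp b hb0
    simp only [hE, hz] at h5
    linarith
  have hAhalf : ∀ x, 0 < x → 1 / 2 ≤ A x := by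
    intro x hx
    have h5 := hEge x hx fun y hy _ => (hApos y hy).le
    have h6 := hp x hx
    simp only [hE] at h5
    nlinarith [hApos x hx]
  -- The derivative of `xφ` is `(2A - 1)φ`, so `A ≥ 1/2` is the threshold needed here.
  have hmono : MonotoneOn (fun x => x * φ x) (Set.Ici 1) := by
    have hd : ∀ x, HasDerivAt (fun x => x * φ x) (1 * φ x + x * φ' x) x :=
      fun x => (hasDerivAt_id' x).mul (h1 x)
    refine monotoneOn_of_deriv_nonneg (convex_Ici 1)
      (fun x _ => (hd x).continuousAt.continuousWithinAt)
      (fun x _ => (hd x).differentiableAt.differentiableWithinAt) ?_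
    intro x hx
    rw [interior_Ici] at hx
    have hx0 : (0 : ℝ) < x := zero_lt_one.trans hx
    have h5 := hAhalf x hx0
    have hφ := hpos x
    have h7 : x * φ' x = (A x - 1) * (2 * φ x) := by
      simp only [hA]; field_simp; ring
    rw [(hd x).deriv, h7]
    nlinarith
  have hφ1 := hpos 1
  -- At `x = 1 + 1/φ(1)` one gets `x²φ(x) ≥ xφ(1) = φ(1) + 1 > 1/4`.
  have hx1 : 1 ≤ 1 + 1 / φ 1 := by have : 0 < 1 / φ 1 := by positivity
                                   linarith
  have h8 := hmono (Set.mem_Ici.2 le_rfl) hx1 hx1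
  have h9 := hp (1 + 1 / φ 1) (by linarith)
  simp only [one_mul] at h8
  have h10 : (1 + 1 / φ 1) * φ 1 = φ 1 + 1 := by field_simp
  nlinarith

/-! ### The generated metric along an axis -/

section Generated

open Set MeasureTheory

/-- The singularity at `0` is removable, with value the one-sided derivative of `ξ`; otherwise the
integral in `hFun` could be the default `0`. -/
theorem intervalIntegrable_div_self {ξ : ℝ → ℝ} (hξ : ContDiffOn ℝ ∞ ξ (Ici 0)) (h0 : ξ 0 = 0)
    {a b : ℝ} (ha : 0 ≤ a) (hb : 0 ≤ b) :
    IntervalIntegrable (fun s => ξ s / s) volume a b := by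
  set F : ℝ → ℝ := Function.update (fun s => ξ s / s) 0 (derivWithin ξ (Ici 0) 0) with hF
  have hFc : ContinuousOn F (Ici 0) := by
    intro x hx
    rcases (mem_Ici.1 hx).eq_or_lt with h | h
    · subst h
      have hd : HasDerivWithinAt ξ (derivWithin ξ (Ici 0) 0) (Ici 0) 0 :=
        ((hξ.differentiableOn (by simp)) 0 hx).hasDerivWithinAt
      rw [hF, continuousWithinAt_update_same]
      refine (hasDerivWithinAt_iff_tendsto_slope.1 hd).congr fun s => ?_
      simp [slope_def_field, h0]
    · have hc : ContinuousWithinAt (fun s => ξ s / s) (Ici 0) x :=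
        (hξ.continuousOn x hx).div continuousWithinAt_id h.ne'
      exact (continuousWithinAt_update_of_ne h.ne').2 hc
  have hFi : IntervalIntegrable F volume a b :=
    (hFc.mono fun x hx => (le_min ha hb).trans hx.1).intervalIntegrable
  refine hFi.congr fun s hs => ?_
  have hs0 : s ≠ 0 := ((le_min ha hb).trans_lt hs.1).ne'
  simp [hF, hs0]

theorem continuousOn_hFun {ξ : ℝ → ℝ} (hξ : ContDiffOn ℝ ∞ ξ (Ici 0)) (h0 : ξ 0 = 0) (C : ℝ) :
    ContinuousOn (hFun C ξ) (Ici 0) := by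
  intro x hx
  have hx0 : (0 : ℝ) ≤ x := hx
  have hc : ContinuousOn (fun r => ∫ s in (0 : ℝ)..r, ξ s / s) (Icc 0 (x + 1)) := by
    have := intervalIntegral.continuousOn_primitive_interval
      (μ := volume) (f := fun s => ξ s / s) (a := 0) (b := x + 1)
      (by
        rw [uIcc_of_le (by linarith), integrableOn_Icc_iff_integrableOn_Ioc]
        exact (intervalIntegrable_iff_integrableOn_Ioc_of_le (by linarith)).1
          (intervalIntegrable_div_self hξ h0 le_rfl (by linarith)))
    rwa [uIcc_of_le (by linarith)] at this
  have h1 : ContinuousWithinAt (hFun C ξ) (Icc 0 (x + 1)) x :=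
    continuousWithinAt_const.mul
      (Real.continuous_exp.continuousAt.comp_continuousWithinAt (hc x ⟨hx0, by linarith⟩).neg)
  refine h1.mono_of_mem_nhdsWithin ?_
  exact mem_nhdsWithin.2 ⟨Iio (x + 1), isOpen_Iio, by simp, fun y hy => ⟨hy.2, le_of_lt hy.1⟩⟩

/-- This is `(r f)' = h`; the left side is the radial coefficient of the metric. -/
theorem fFun_add_deriv_mul {ξ : ℝ → ℝ} (hξ : ContDiffOn ℝ ∞ ξ (Ici 0)) (h0 : ξ 0 = 0) (C : ℝ)
    {r : ℝ} (hr : 0 < r) : fFun C ξ r + deriv (fFun C ξ) r * r = hFun C ξ r := by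
  have hc := continuousOn_hFun hξ h0 C
  have hca : ContinuousAt (hFun C ξ) r := hc.continuousAt (Ici_mem_nhds hr)
  have hint : HasDerivAt (fun u => ∫ s in (0 : ℝ)..u, hFun C ξ s) (hFun C ξ r) r := by
    refine intervalIntegral.integral_hasDerivAt_right ?_ ?_ hca
    · exact (hc.mono (by rw [uIcc_of_le hr.le]; exact Icc_subset_Ici_self)).intervalIntegrable
    · exact (hc.mono Ioi_subset_Ici_self).stronglyMeasurableAtFilter isOpen_Ioi r hr
  have hd := (hasDerivAt_inv hr.ne').mul hint
  have hfd : HasDerivAt (fFun C ξ) _ r := hd.congr_of_eventuallyEq (by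
    filter_upwards [lt_mem_nhds hr] with u hu
    simp [fFun, hu.ne'])
  rw [hfd.deriv]
  simp only [fFun, hr.ne', if_false]
  field_simp
  ring

/-- Beyond `1`, `r h(r) = h(1) exp ∫₁ʳ (1 - ξ)/s`, since `r = exp ∫₁ʳ 1/s`; on `[0, 1]` compactness
suffices. -/
theorem exists_bound_mul_hFun {ξ : ℝ → ℝ} (hξ : ContDiffOn ℝ ∞ ξ (Ici 0)) (h0 : ξ 0 = 0) {C : ℝ}
    (hC : 0 < C) (hb : ∃ c : ℝ, ∀ r : ℝ, 1 ≤ r → (∫ s in (1 : ℝ)..r, (1 - ξ s) / s) ≤ c) :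
    ∃ M : ℝ, 0 < M ∧ ∀ r, 0 ≤ r → r * hFun C ξ r ≤ M := by
  obtain ⟨c, hc⟩ := hb
  have hcont : ContinuousOn (fun r => r * hFun C ξ r) (Icc 0 1) :=
    continuousOn_id.mul ((continuousOn_hFun hξ h0 C).mono Icc_subset_Ici_self)
  obtain ⟨M, hM⟩ := (isCompact_Icc.image_of_continuousOn hcont).bddAbove
  have h1 : 0 < hFun C ξ 1 := by unfold hFun; positivity
  refine ⟨max M (hFun C ξ 1 * Real.exp c), lt_max_of_lt_right (by positivity), fun r hr => ?_⟩
  rcases le_total r 1 with h | h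
  · exact le_max_of_le_left (hM ⟨r, ⟨hr, h⟩, rfl⟩)
  · refine le_max_of_le_right ?_
    have hr0 : 0 < r := by linarith
    have hi1 := intervalIntegrable_div_self hξ h0 le_rfl zero_le_one
    have hi2 := intervalIntegrable_div_self hξ h0 zero_le_one hr0.le
    have hinv : IntervalIntegrable (fun s : ℝ => 1 / s) volume 1 r :=
      intervalIntegral.intervalIntegrable_one_div
        (fun x hx => by rw [uIcc_of_le h] at hx; linarith [hx.1]) continuousOn_id
    have hsplit : (∫ s in (1 : ℝ)..r, (1 - ξ s) / s)
        = Real.log r - ∫ s in (1 : ℝ)..r, ξ s / s := by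
      simp_rw [sub_div]
      rw [intervalIntegral.integral_sub hinv hi2, integral_one_div_of_pos one_pos hr0, div_one]
    have heq : r * hFun C ξ r
        = hFun C ξ 1 * Real.exp (∫ s in (1 : ℝ)..r, (1 - ξ s) / s) := by
      unfold hFun
      rw [hsplit, ← intervalIntegral.integral_add_adjacent_intervals hi1 hi2, neg_add,
        Real.exp_add, sub_eq_add_neg, Real.exp_add (Real.log r), Real.exp_log hr0]
      ring
    rw [heq]
    gcongr
    exact hc r h

theorem coeff_re_on_axis {n : ℕ} {g : KahlerMetric n} {ξ : ℝ → ℝ} {C : ℝ}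
    (hξ : ContDiffOn ℝ ∞ ξ (Ici 0)) (h0 : ξ 0 = 0)
    (hg : ∀ (z : Fin n → ℂ) (i j : Fin n), g.coeff z i j =
        (if i = j then ((fFun C ξ (∑ m, ‖z m‖ ^ 2) : ℝ) : ℂ) else 0)
          + ((deriv (fFun C ξ) (∑ m, ‖z m‖ ^ 2) : ℝ) : ℂ) * star (z i) * z j)
    (i : Fin n) {x : ℝ} (hx : 0 < x) :
    (g.coeff (Pi.single i (x : ℂ)) i i).re = hFun C ξ (x ^ 2) := by
  have hs : ∑ m, ‖(Pi.single i (x : ℂ) : Fin n → ℂ) m‖ ^ 2 = x ^ 2 := by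
    rw [Finset.sum_eq_single i (by intro b _ hb; simp [hb]) (by simp)]
    simp
  rw [hg, hs, ← fFun_add_deriv_mul hξ h0 C (by positivity : 0 < x ^ 2)]
  simp
  ring

end Generated

/-! ### Curvature of an invariant metric along an axis -/

section Invariant

open Matrix

/-- Cauchy–Schwarz for the form of `M⁻¹`. Applied to the first derivatives of the metric, it
discards the second fundamental form of the axis. -/
theorem norm_sq_div_le_inv_form {n : ℕ} {M : Matrix (Fin n) (Fin n) ℂ} (hM : M.PosDef)
    (a : Fin n → ℂ) (i : Fin n) :
    ‖a i‖ ^ 2 / (M i i).re ≤ (∑ p, ∑ q, M⁻¹ q p * a q * star (a p)).re := by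
  have hii : 0 < M i i := hM.diag_pos
  have him : M i i = ((M i i).re : ℂ) := by
    apply Complex.ext <;> simp [(Complex.pos_iff.1 hii).2.symm]
  have hre : 0 < (M i i).re := (Complex.pos_iff.1 hii).1
  have hu : IsUnit M.det := (Matrix.isUnit_iff_isUnit_det M).1 hM.isUnit
  set c : Fin n → ℂ := star a with hc
  set b : Fin n → ℂ := M⁻¹ *ᵥ c with hb
  have hMb : M *ᵥ b = c := by rw [hb, mulVec_mulVec, Matrix.mul_nonsing_inv _ hu, one_mulVec]
  have hH : Mᴴ = M := hM.isHermitian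
  -- This `t` minimises the form of `M` on `b - t • e`; nonnegativity of the minimum is the claim.
  set t : ℂ := c i / M i i with ht
  set e : Fin n → ℂ := Pi.single i 1 with he
  have hnn := (hM.posSemidef.dotProduct_mulVec_nonneg (b - t • e))
  have hform : (∑ p, ∑ q, M⁻¹ q p * a q * star (a p)) = star c ⬝ᵥ b := by
    simp only [hb, hc, dotProduct, mulVec, star_star, Pi.star_apply, Finset.mul_sum]
    rw [Finset.sum_comm]
    refine Finset.sum_congr rfl fun q _ => Finset.sum_congr rfl fun p _ => ?_
    ring
  have h1 : star b ⬝ᵥ c = star c ⬝ᵥ b := by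
    have : star b ⬝ᵥ M *ᵥ b = star (M *ᵥ b) ⬝ᵥ b := by
      rw [star_mulVec M b, hH, dotProduct_mulVec]
    rwa [hMb] at this
  have h2 : star e ⬝ᵥ c = c i := by simp [he]
  have h3 : star b ⬝ᵥ M *ᵥ e = star (c i) := by
    rw [dotProduct_mulVec]
    have : star b ᵥ* M = star c := by rw [← hMb, star_mulVec M b, hH]
    rw [this]; simp [he]
  have h4 : star e ⬝ᵥ M *ᵥ e = M i i := by simp [he]
  have hexp : star (b - t • e) ⬝ᵥ M *ᵥ (b - t • e)
      = star c ⬝ᵥ b - (‖a i‖ ^ 2 / (M i i).re : ℝ) := by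
    rw [mulVec_sub, mulVec_smul, hMb, star_sub, star_smul, sub_dotProduct, dotProduct_sub,
      dotProduct_sub, smul_dotProduct, smul_dotProduct, dotProduct_smul, dotProduct_smul,
      h1, h2, h3, h4]
    have h5 : (‖a i‖ ^ 2 : ℂ) = star (c i) * c i := by
      simp only [hc, Pi.star_apply, star_star]
      rw [RCLike.star_def, Complex.mul_conj']
    have hst : star t = star (c i) / M i i := by
      rw [ht, star_div₀, him]; simp
    push_cast
    rw [h5, ← him, smul_eq_mul, smul_eq_mul, smul_eq_mul, smul_eq_mul, hst, ht]
    field_simp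
    ring
  rw [hexp] at hnn
  have := (Complex.le_def.1 hnn).1
  rw [Complex.sub_re, Complex.ofReal_re, Complex.zero_re] at this
  rw [hform]
  linarith

variable {n : ℕ}

theorem KahlerMetric.sqNorm_single (g : KahlerMetric n) (z : Fin n → ℂ) (i : Fin n) :
    g.sqNorm z (Pi.single i 1) = (g.coeff z i i).re := by
  simp [KahlerMetric.sqNorm, KahlerMetric.herm, Pi.single_apply, apply_ite]

theorem KahlerMetric.coeff_diag (g : KahlerMetric n) (z : Fin n → ℂ) (i : Fin n) :
    g.coeff z i i = ((g.coeff z i i).re : ℂ) := by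
  have hii : 0 < g.coeff z i i := (g.posDef z).diag_pos
  apply Complex.ext <;> simp [(Complex.pos_iff.1 hii).2.symm]

theorem dzbar_star (k : Fin n) {F : (Fin n → ℂ) → ℂ} (hF : Differentiable ℝ F) (z : Fin n → ℂ) :
    dzbar k (fun w => star (F w)) z = star (dz k F z) := by
  have h : fderiv ℝ (fun w => star (F w)) z
      = (Complex.conjCLE : ℂ →L[ℝ] ℂ).comp (fderiv ℝ F z) :=
    ((Complex.conjCLE : ℂ →L[ℝ] ℂ).hasFDerivAt.comp z (hF z).hasFDerivAt).fderiv
  simp only [dzbar, dz, h]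
  simp [sub_eq_add_neg]

theorem fderiv_ofReal_comp {f : (Fin n → ℂ) → ℝ} {w : Fin n → ℂ} (hf : DifferentiableAt ℝ f w)
    (v : Fin n → ℂ) : fderiv ℝ (fun w => (f w : ℂ)) w v = (fderiv ℝ f w v : ℂ) := by
  have h : fderiv ℝ (fun w => (f w : ℂ)) w = Complex.ofRealCLM.comp (fderiv ℝ f w) :=
    (Complex.ofRealCLM.hasFDerivAt.comp w hf.hasFDerivAt).fderiv
  rw [h]; simp

/-- The real second derivatives in the coordinate `z_k` of a real function give `∂_k ∂_k̄`. -/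
theorem re_dz_dzbar_ofReal (k : Fin n) {H : (Fin n → ℂ) → ℝ} (hH : ContDiff ℝ ∞ H)
    (z : Fin n → ℂ) :
    (dz k (dzbar k (fun w => (H w : ℂ))) z).re
      = 1 / 4 * (fderiv ℝ (fun w => fderiv ℝ H w (Pi.single k 1)) z (Pi.single k 1)
        + fderiv ℝ (fun w => fderiv ℝ H w (Pi.single k Complex.I)) z (Pi.single k Complex.I)) := by
  have hd : ∀ v : Fin n → ℂ, Differentiable ℝ fun w => fderiv ℝ H w v := fun v =>
    ((hH.fderiv_right (m := ∞) (by simp)).clm_apply contDiff_const).differentiable (by simp)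
  have hHd : Differentiable ℝ H := hH.differentiable (by simp)
  have h2 : dzbar k (fun w => (H w : ℂ)) = fun w => (1 / 2 : ℂ) *
      ((fderiv ℝ H w (Pi.single k 1) : ℂ)
        + Complex.I * (fderiv ℝ H w (Pi.single k Complex.I) : ℂ)) := by
    funext w; simp only [dzbar, fderiv_ofReal_comp (hHd _)]
  have h3 : ∀ v : Fin n → ℂ, fderiv ℝ (fun w => (1 / 2 : ℂ) *
      ((fderiv ℝ H w (Pi.single k 1) : ℂ)
        + Complex.I * (fderiv ℝ H w (Pi.single k Complex.I) : ℂ))) z v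
      = (1 / 2 : ℂ) * ((fderiv ℝ (fun w => fderiv ℝ H w (Pi.single k 1)) z v : ℂ)
        + Complex.I * (fderiv ℝ (fun w => fderiv ℝ H w (Pi.single k Complex.I)) z v : ℂ)) := by
    intro v
    have hc : ∀ u : Fin n → ℂ, DifferentiableAt ℝ (fun w => ((fderiv ℝ H w u : ℝ) : ℂ)) z :=
      fun u => Complex.ofRealCLM.differentiableAt.comp z (hd u z)
    rw [fderiv_const_mul ((hc _).fun_add ((hc _).const_mul _)),
      fderiv_fun_add (hc _) ((hc _).const_mul _), fderiv_const_mul (hc _)]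
    simp [fderiv_ofReal_comp (hd _ _), mul_add]
  rw [h2]
  simp only [dz, h3]
  simp
  ring

theorem KahlerMetric.coeff_diag_rotate {g : KahlerMetric n} (hg : g.IsUnitaryInvariant)
    (i : Fin n) {c : ℂ} (hc : ‖c‖ = 1) (z : Fin n → ℂ) :
    g.coeff (c • z) i i = g.coeff z i i := by
  have hcc : star c * c = 1 := by
    rw [RCLike.star_def, Complex.conj_mul', hc]; simp
  have hU : (c • (1 : Matrix (Fin n) (Fin n) ℂ)) ∈ Matrix.unitaryGroup (Fin n) ℂ := by
    rw [Matrix.mem_unitaryGroup_iff']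
    simp [smul_smul, star_smul, mul_comm c]
    rw [← RCLike.star_def, hcc, one_smul]
  have h := hg _ hU z (Pi.single i 1) (Pi.single i 1)
  simp only [smul_mulVec, one_mulVec, KahlerMetric.herm] at h
  simp [Pi.single_apply, apply_ite] at h
  rw [mul_assoc, mul_comm c, ← RCLike.star_def, hcc, mul_one] at h
  exact h

/-- A function constant along the circles `θ ↦ e^{iθ} z` has vanishing angular derivative. -/
theorem fderiv_I_smul_eq_zero {H : (Fin n → ℂ) → ℝ} (hH : Differentiable ℝ H)
    (hrot : ∀ (c : ℂ) z, ‖c‖ = 1 → H (c • z) = H z) (z : Fin n → ℂ) :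
    fderiv ℝ H z (Complex.I • z) = 0 := by
  have hexp : HasDerivAt (fun θ : ℝ => Complex.exp (θ * Complex.I)) Complex.I 0 := by
    have := (((hasDerivAt_id' (0 : ℝ)).ofReal_comp).mul_const Complex.I).cexp
    simpa using this
  have hcurve : HasDerivAt (fun θ : ℝ => Complex.exp (θ * Complex.I) • z) (Complex.I • z) 0 :=
    hexp.smul_const z
  have hcomp : HasDerivAt (fun θ : ℝ => H (Complex.exp (θ * Complex.I) • z))
      (fderiv ℝ H z (Complex.I • z)) 0 := by
    have hz : Complex.exp ((0 : ℝ) * Complex.I) • z = z := by simp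
    have hf : HasFDerivAt H (fderiv ℝ H z) (Complex.exp ((0 : ℝ) * Complex.I) • z) := by
      rw [hz]; exact (hH z).hasFDerivAt
    exact hf.comp_hasDerivAt 0 hcurve
  have hconst : (fun θ : ℝ => H (Complex.exp (θ * Complex.I) • z)) = fun _ => H z := by
    funext θ
    exact hrot _ _ (Complex.norm_exp_ofReal_mul_I θ)
  rw [hconst] at hcomp
  exact hcomp.unique (hasDerivAt_const _ _)

/-- Differentiating `DH_w(iw) = 0` at `x e_k` in the direction `i e_k` yields this, the `φ'/x` term
of the polar Laplacian. -/
theorem smul_fderiv_fderiv_I {H : (Fin n → ℂ) → ℝ} (hH : ContDiff ℝ ∞ H)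
    (hrot : ∀ (c : ℂ) z, ‖c‖ = 1 → H (c • z) = H z) (k : Fin n) (x : ℝ) :
    x * fderiv ℝ (fun w => fderiv ℝ H w (Pi.single k Complex.I)) (Pi.single k (x : ℂ))
        (Pi.single k Complex.I)
      = fderiv ℝ H (Pi.single k (x : ℂ)) (Pi.single k 1) := by
  have hzero : (fun w => fderiv ℝ H w (Complex.I • w)) = fun _ => 0 :=
    funext (fderiv_I_smul_eq_zero (hH.differentiable (by simp)) hrot)
  have hD : Differentiable ℝ (fderiv ℝ H) :=
    (hH.fderiv_right (m := ∞) (by simp)).differentiable (by simp)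
  set z : Fin n → ℂ := Pi.single k (x : ℂ) with hz
  set J : (Fin n → ℂ) →L[ℝ] (Fin n → ℂ) :=
    Complex.I • ContinuousLinearMap.id ℝ (Fin n → ℂ) with hJ
  have h1 : HasFDerivAt (fun w => fderiv ℝ H w (Complex.I • w)) _ z :=
    (hD z).hasFDerivAt.clm_apply (J.hasFDerivAt (x := z))
  rw [hzero] at h1
  have h2 := congrArg (fun T => T (Pi.single k Complex.I)) (h1.unique (hasFDerivAt_const _ _))
  have h3 : fderiv ℝ (fun w => fderiv ℝ H w (Pi.single k Complex.I)) z (Pi.single k Complex.I)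
      = fderiv ℝ (fderiv ℝ H) z (Pi.single k Complex.I) (Pi.single k Complex.I) := by
    rw [fderiv_clm_apply (hD z) (differentiableAt_const _)]
    simp
  have e1 : J (Pi.single k Complex.I) = -Pi.single k 1 := by
    simp [hJ, ← Pi.single_smul, ← Pi.single_neg]
  have e2 : Complex.I • z = x • Pi.single k Complex.I := by
    simp [hz, ← Pi.single_smul, mul_comm]
  simp [e1, e2] at h2
  rw [h3]
  linarith

/-- The upper bound `1` on the holomorphic sectional curvature in the radial direction. -/
theorem KahlerMetric.neg_re_dz_dzbar_add_le {g : KahlerMetric n} (hb : g.BisectionalLE 1)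
    (i : Fin n) (z : Fin n → ℂ) :
    -(dz i (dzbar i (fun w => g.coeff w i i)) z).re
      + ‖dz i (fun w => g.coeff w i i) z‖ ^ 2 / (g.coeff z i i).re ≤ (g.coeff z i i).re ^ 2 := by
  have hpos : 0 < (g.coeff z i i).re := (Complex.pos_iff.1 (g.posDef z).diag_pos).1
  have hne : (Pi.single i 1 : Fin n → ℂ) ≠ 0 := by simp
  have h := hb z (Pi.single i 1) (Pi.single i 1) hne hne
  have hsq : g.sqNorm z (Pi.single i 1) = (g.coeff z i i).re :=
    g.sqNorm_single z i
  rw [KahlerMetric.bisectional, hsq, div_le_one (by positivity)] at h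
  have hsum : (∑ a, ∑ b, ∑ k, ∑ l, g.curvature a b k l z * (Pi.single i 1 : Fin n → ℂ) a
      * star ((Pi.single i 1 : Fin n → ℂ) b) * (Pi.single i 1 : Fin n → ℂ) k
      * star ((Pi.single i 1 : Fin n → ℂ) l)) = g.curvature i i i i z := by
    simp [Pi.single_apply, apply_ite]
  rw [hsum, KahlerMetric.curvature] at h
  have hbar : ∀ p, dzbar i (fun w => g.coeff w p i) z
      = star (dz i (fun w => g.coeff w i p) z) := by
    intro p
    rw [← dzbar_star i ((g.smooth i p).differentiable (by simp))]
    congr 1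
    funext w
    exact ((g.posDef w).isHermitian.apply p i).symm
  have hCS := norm_sq_div_le_inv_form (g.posDef z) (fun q => dz i (fun w => g.coeff w i q) z) i
  simp only [hbar, Complex.add_re, Complex.neg_re] at h
  rw [sq (g.coeff z i i).re]
  exact (add_le_add_right hCS _).trans h

/-- A `U(n)`-invariant Kähler metric with bisectional curvature at most `1` has
`|z|² g(∂_r, ∂_r) > 1 / 4` somewhere along each coordinate axis. -/
theorem KahlerMetric.exists_quarter_lt_coeff {g : KahlerMetric n} (hg : g.IsUnitaryInvariant)
    (hb : g.BisectionalLE 1) (i : Fin n) :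
    ∃ x : ℝ, 0 < x ∧ 1 / 4 < x ^ 2 * (g.coeff (Pi.single i (x : ℂ)) i i).re := by
  set H : (Fin n → ℂ) → ℝ := fun z => (g.coeff z i i).re with hHdef
  have hH : ContDiff ℝ ∞ H := Complex.reCLM.contDiff.comp (g.smooth i i)
  have hcoe : (fun z => g.coeff z i i) = fun z => (H z : ℂ) := funext fun z => g.coeff_diag z i
  have hrot : ∀ (c : ℂ) z, ‖c‖ = 1 → H (c • z) = H z := fun c z hc => by
    simp only [hHdef, KahlerMetric.coeff_diag_rotate hg i hc]
  have hpos : ∀ z, 0 < H z := fun z => (Complex.pos_iff.1 (g.posDef z).diag_pos).1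
  have hHd : Differentiable ℝ H := hH.differentiable (by simp)
  have hDd : Differentiable ℝ fun w => fderiv ℝ H w (Pi.single i 1) :=
    ((hH.fderiv_right (m := ∞) (by simp)).clm_apply contDiff_const).differentiable (by simp)
  have hline : ∀ x : ℝ, HasDerivAt (fun x : ℝ => (Pi.single i (x : ℂ) : Fin n → ℂ))
      (Pi.single i 1) x := by
    intro x
    have h : HasDerivAt (fun x : ℝ => (x : ℂ) • (Pi.single i 1 : Fin n → ℂ))
        ((1 : ℂ) • Pi.single i 1) x := (hasDerivAt_id' x).ofReal_comp.smul_const _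
    simpa [← Pi.single_smul] using h
  refine exists_quarter_lt_sq_mul_of_curvature_le (φ := fun x : ℝ => H (Pi.single i (x : ℂ)))
    (φ' := fun x : ℝ => fderiv ℝ H (Pi.single i (x : ℂ)) (Pi.single i 1))
    (φ'' := fun x : ℝ => fderiv ℝ (fun w => fderiv ℝ H w (Pi.single i 1)) (Pi.single i (x : ℂ))
      (Pi.single i 1))
    (fun x => (hHd _).hasFDerivAt.comp_hasDerivAt x (hline x))
    (fun x => (hDd _).hasFDerivAt.comp_hasDerivAt x (hline x)) (fun x => hpos _) ?_
  intro x hx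
  set z : Fin n → ℂ := Pi.single i (x : ℂ) with hz
  have hcurv := KahlerMetric.neg_re_dz_dzbar_add_le hb i z
  have hang := smul_fderiv_fderiv_I hH hrot i x
  have hI : fderiv ℝ H z (Pi.single i Complex.I) = 0 := by
    have h := fderiv_I_smul_eq_zero hHd hrot z
    have e : Complex.I • z = x • Pi.single i Complex.I := by
      simp [hz, ← Pi.single_smul, mul_comm]
    rw [e, map_smul, smul_eq_mul] at h
    exact (mul_eq_zero.1 h).resolve_left hx.ne'
  have hdz : ‖dz i (fun w => (H w : ℂ)) z‖ ^ 2 = fderiv ℝ H z (Pi.single i 1) ^ 2 / 4 := by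
    rw [dz, fderiv_ofReal_comp (hHd z), fderiv_ofReal_comp (hHd z), hI]
    simp [mul_pow, Complex.norm_real]
    ring
  rw [hcoe, re_dz_dzbar_ofReal i hH, hdz] at hcurv
  change _ + _ / H z ≤ H z ^ 2 at hcurv
  rw [← hz] at hang
  have h3 : fderiv ℝ H z (Pi.single i 1) / x
      = fderiv ℝ (fun w => fderiv ℝ H w (Pi.single i Complex.I)) z (Pi.single i Complex.I) := by
    rw [← hang]; field_simp
  have h4 : fderiv ℝ H z (Pi.single i 1) ^ 2 / 4 / H z
      = fderiv ℝ H z (Pi.single i 1) ^ 2 / H z / 4 := by ring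
  rw [h4] at hcurv
  simp only [h3]
  linarith

end Invariant

end UnKahler

theorem mainTheorem8 (n : ℕ) (hn : 1 ≤ n) (g : UnKahler.KahlerMetric n)
    (hinv : g.IsUnitaryInvariant) (ξ : ℝ → ℝ) (hgen : g.IsGeneratedBy ξ)
    (hξ : ∃ c : ℝ, ∀ r : ℝ, 1 ≤ r → (∫ s in (1 : ℝ)..r, (1 - ξ s) / s) ≤ c) :
    ∃ c₁ : ℝ, 0 < c₁ ∧
      ∀ g' : UnKahler.KahlerMetric n, g'.IsUnitaryInvariant → g'.BisectionalLE 1 →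
        ∀ α : ℝ, 0 < α →
          (∀ z X : Fin n → ℂ, α * g'.sqNorm z X ≤ g.sqNorm z X) → α ≤ c₁ := by
  obtain ⟨hsm, h0, C, hC, hg⟩ := hgen
  obtain ⟨M, hM, hbound⟩ := UnKahler.exists_bound_mul_hFun hsm h0 hC hξ
  -- The factor `4` inverts the `1/4` of the comparison.
  refine ⟨4 * M, by positivity, fun g' hinv' hb' α hα hle => ?_⟩
  obtain ⟨x, hx, hlt⟩ :=
    UnKahler.KahlerMetric.exists_quarter_lt_coeff hinv' hb' (⟨0, hn⟩ : Fin n)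
  have h1 := hle (Pi.single ⟨0, hn⟩ (x : ℂ)) (Pi.single ⟨0, hn⟩ 1)
  rw [UnKahler.KahlerMetric.sqNorm_single, UnKahler.KahlerMetric.sqNorm_single,
    UnKahler.coeff_re_on_axis hsm h0 hg _ hx] at h1
  have h2 := hbound (x ^ 2) (sq_nonneg x)
  have h3 := mul_le_mul_of_nonneg_left h1 (sq_nonneg x)
  have h4 := mul_lt_mul_of_pos_left hlt hα
  linarith
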